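/- For integers $m,d\ge 1$ identify $L(\mathbb{C}^d)$ with the complex $d\times d$ matrices. A Schur channel on $L(\mathbb{C}^d)$ is a map $X\mapsto S\circ X$ (entrywise product), where $S$ is a positive semidefinite $d\times d$ matrix with all diagonal entries equal to $1$; let $\mathrm{S}_d$ be the set of these. Let $\mathrm{Conv}(\mathbb{U}_d)$ be the convex hull of the unitary channels $X\mapsto UXU^\dagger$, $U$ a unitary $d\times d$ matrix, and let $\mathrm{Conv}(\mathbb{U}_{m\otimes d})$ be the analogous set on $L(\mathbb{C}^m\otimes\mathbb{C}^d)$. For a linear map $\Theta$ from $L(H)$ to itself, with $H$ finite-dimensional, put $$\|\Theta\|_\diamond=\sup_{n\ge1}\ \sup_{\|X\|_1\le1}\big\|(\Theta\otimes I_{L(\mathbb{C}^n)})(X)\big\|_1,\qquad \|X\|_1=\mathrm{Tr}\sqrt{X^\dagger X},$$ where $X$ ranges over $L(H\otimes\mathbb{C}^n)$, and for a set $C$ of such maps put $D(\Theta,C)=\inf_{\Xi\in C}\|\Theta-\Xi\|_\diamond$. Then for all Schur channels $\Phi\in\mathrm{S}_d$ and $\Psi\in\mathrm{S}_m$, $$D\big(\Psi\otimes\Phi,\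 \mathrm{Conv}(\mathbb{U}_{m\otimes d})\big)\ \ge\ \tfrac12\,D\big(\Phi,\ \mathrm{Conv}(\mathbb{U}_d)\big).$$ -/

import Mathlib

namespace SchurChannels

open scoped Kronecker MatrixOrder ComplexOrder ENNReal

/-- The super-operators on `L(H)`, where `H` has a fixed orthonormal basis indexed by `ι`. -/
abbrev SuperOp (ι : Type*) : Type _ := Matrix ι ι ℂ →ₗ[ℂ] Matrix ι ι ℂ

/-- The trace norm `‖X‖₁ = Tr |X|`, where `|X| = √(X† X)`. -/
noncomputable def traceNorm {ι : Type*} [Fintype ι] [DecidableEq ι] (X : Matrix ι ι ℂ) : ℝ :=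
  (CFC.sqrt (X.conjTranspose * X)).trace.re

/-- The tensor product `Φ ⊗ Ψ` of two super-operators, acting on the operators on the tensor
product of the two spaces. It is the linear extension of
`E_{ij} ⊗ E_{kl} ↦ Φ(E_{ij}) ⊗ Ψ(E_{kl})`; see `tensor_kronecker`. -/
noncomputable def tensor {ι κ : Type*} [Fintype ι] [DecidableEq ι] [Fintype κ] [DecidableEq κ]
    (Φ : SuperOp ι) (Ψ : SuperOp κ) : SuperOp (ι × κ) where
  toFun X := ∑ i, ∑ j, ∑ k, ∑ l,
    X (i, k) (j, l) • (Φ (Matrix.single i j 1) ⊗ₖ Ψ (Matrix.single k l 1))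
  map_add' X Y := by simp only [Matrix.add_apply, add_smul, Finset.sum_add_distrib]
  map_smul' c X := by
    simp only [Matrix.smul_apply, smul_assoc, Finset.smul_sum, RingHom.id_apply]

/-- `Φ ⊗ Ψ` acts on product operators by `A ⊗ B ↦ Φ(A) ⊗ Ψ(B)`. -/
theorem tensor_kronecker {ι κ : Type*} [Fintype ι] [DecidableEq ι] [Fintype κ] [DecidableEq κ]
    (Φ : SuperOp ι) (Ψ : SuperOp κ) (A : Matrix ι ι ℂ) (B : Matrix κ κ ℂ) :
    tensor Φ Ψ (A ⊗ₖ B) = Φ A ⊗ₖ Ψ B := by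
  have hΦ : Φ A = ∑ i, ∑ j, A i j • Φ (Matrix.single i j 1) := by
    conv_lhs => rw [Matrix.matrix_eq_sum_single A]
    simp only [map_sum, ← map_smul, Matrix.smul_single, smul_eq_mul, mul_one]
  have hΨ : Ψ B = ∑ k, ∑ l, B k l • Ψ (Matrix.single k l 1) := by
    conv_lhs => rw [Matrix.matrix_eq_sum_single B]
    simp only [map_sum, ← map_smul, Matrix.smul_single, smul_eq_mul, mul_one]
  ext ⟨a, b⟩ ⟨a', b'⟩
  rw [hΦ, hΨ]
  simp only [tensor, LinearMap.coe_mk, AddHom.coe_mk, Matrix.sum_apply, Matrix.smul_apply,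
    Matrix.kroneckerMap_apply, smul_eq_mul]
  simp only [Finset.sum_mul]
  simp only [Finset.mul_sum]
  refine Finset.sum_congr rfl fun i _ => ?_
  refine Finset.sum_congr rfl fun j _ => ?_
  refine Finset.sum_congr rfl fun k _ => ?_
  refine Finset.sum_congr rfl fun l _ => ?_
  ring

/-- The trace norm of a super-operator, `‖Φ‖₁ = sup {‖Φ(X)‖₁ : ‖X‖₁ ≤ 1}`. -/
noncomputable def superTraceNorm {ι : Type*} [Fintype ι] [DecidableEq ι] (Φ : SuperOp ι) :
    ℝ≥0∞ :=
  ⨆ X : Matrix ι ι ℂ, ⨆ _ : traceNorm X ≤ 1, ENNReal.ofReal (traceNorm (Φ X))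

/-- The diamond norm `‖Φ‖_⋄ = sup_{n ≥ 1} ‖Φ ⊗ I_{L(H_n)}‖₁`. -/
noncomputable def diamondNorm {ι : Type*} [Fintype ι] [DecidableEq ι] (Φ : SuperOp ι) : ℝ≥0∞ :=
  ⨆ n : ℕ, ⨆ _ : 1 ≤ n, superTraceNorm (tensor Φ (LinearMap.id : SuperOp (Fin n)))

/-- The distance `D(Φ, C) = inf {‖Φ - Ψ‖_⋄ : Ψ ∈ C}` of a super-operator from a set. -/
noncomputable def distTo {ι : Type*} [Fintype ι] [DecidableEq ι] (Φ : SuperOp ι)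
    (C : Set (SuperOp ι)) : ℝ≥0∞ :=
  ⨅ Ψ ∈ C, diamondNorm (Φ - Ψ)

/-- The super-operator `X ↦ U X U†`. -/
noncomputable def conjBy {ι : Type*} [Fintype ι] (U : Matrix ι ι ℂ) : SuperOp ι where
  toFun X := U * X * U.conjTranspose
  map_add' X Y := by rw [mul_add, add_mul]
  map_smul' c X := by rw [Matrix.mul_smul, Matrix.smul_mul, RingHom.id_apply]

/-- The set of unitary channels `X ↦ U X U†`, with `U` unitary. -/
def unitaryChannels (ι : Type*) [Fintype ι] [DecidableEq ι] : Set (SuperOp ι) :=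
  {Φ | ∃ U ∈ Matrix.unitaryGroup ι ℂ, Φ = conjBy U}

/-- The convex hull of the unitary channels. -/
def unitaryMixtures (ι : Type*) [Fintype ι] [DecidableEq ι] : Set (SuperOp ι) :=
  convexHull ℝ (unitaryChannels ι)

/-- The Schur multiplier `X ↦ S ∘ X` (entrywise product) induced by `S`. -/
noncomputable def schurMultiplier {ι : Type*} (S : Matrix ι ι ℂ) : SuperOp ι where
  toFun X := S.hadamard X
  map_add' X Y := Matrix.hadamard_add S X Y
  map_smul' c X := Matrix.hadamard_smul S X c

/-- The Schur channels: the Schur multipliers induced by the positive semidefinite matrices all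
of whose diagonal entries are `1`. -/
def schurChannels (ι : Type*) : Set (SuperOp ι) :=
  {Φ | ∃ S : Matrix ι ι ℂ, S.PosSemidef ∧ (∀ k, S k k = 1) ∧ Φ = schurMultiplier S}

end SchurChannels

namespace SchurChannels

open Matrix
open scoped Kronecker MatrixOrder ComplexOrder ENNReal

/-! Restricting to the block of one basis vector of `ℂ^m` turns `Ψ ⊗ Φ` into `Φ`, because the
multiplier of `Ψ` has unit diagonal. It turns a mixture of unitary conjugations into a mixture `∑
w_k C_k · C_k†` of conjugations by contractions. Compression does not increase the diamond norm, so
`Φ` is as close to this mixture as `Ψ ⊗ Φ` was to the original one, say within `e`.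

The contractions are then replaced by unitaries. By polar decomposition, `C_k` is the mean of two
unitaries `C_k ± D_k`. Averaging their conjugations adds exactly the completely positive error `∑
w_k D_k · D_k†`, whose diamond norm is controlled by `R = ∑ w_k D_k† D_k = 1 - ∑ w_k C_k† C_k`.
Since `Φ` preserves the trace, `Tr(R X)` is the trace lost between `Φ` and the contractive mixture,
hence at most `e Tr X` for `X ≥ 0`. So `R ≤ e`, the total error is at most `2e`, and this is the
source of the factor `1/2`. -/

/-! ### Polar decomposition and contractions as means of unitaries. -/

theorem toEuclideanLin_mul {ι : Type*} [Fintype ι] [DecidableEq ι] (A B : Matrix ι ι ℂ) :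
    toEuclideanLin (A * B) = toEuclideanLin A ∘ₗ toEuclideanLin B := by
  ext1 x
  simp [toLpLin_apply, mulVec_mulVec]

/-- Two square matrices with the same Gram matrix differ by a unitary factor on the left. -/
theorem exists_unitary_mul_of_gram_eq {ι : Type*} [Fintype ι] [DecidableEq ι]
    (A T : Matrix ι ι ℂ) (h : Aᴴ * A = Tᴴ * T) :
    ∃ V : Matrix ι ι ℂ, Vᴴ * V = 1 ∧ A = V * T := by
  have hfg : (toEuclideanLin A).adjoint ∘ₗ toEuclideanLin A =
      (toEuclideanLin T).adjoint ∘ₗ toEuclideanLin T := by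
    rw [← toEuclideanLin_conjTranspose_eq_adjoint, ← toEuclideanLin_conjTranspose_eq_adjoint,
      ← toEuclideanLin_mul, h, toEuclideanLin_mul]
  have hA : ∀ V : EuclideanSpace ℂ ι →ₗ[ℂ] EuclideanSpace ℂ ι,
      (∀ x, V (toEuclideanLin T x) = toEuclideanLin A x) → A = toEuclideanLin.symm V * T := by
    intro V hV
    apply toEuclideanLin.injective
    rw [toEuclideanLin_mul, LinearEquiv.apply_symm_apply]
    ext1 x
    exact (hV x).symm
  generalize toEuclideanLin A = f at *
  generalize toEuclideanLin T = g at *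
  have hnorm : ∀ x, ‖f x‖ = ‖g x‖ := by
    intro x
    have h1 : inner ℂ (f x) (f x) = inner ℂ (g x) (g x) :=
      (LinearMap.adjoint_inner_right f x (f x)).symm.trans
        ((congrArg (inner ℂ x) (LinearMap.congr_fun hfg x)).trans
          (LinearMap.adjoint_inner_right g x (g x)))
    rw [inner_self_eq_norm_sq_to_K, inner_self_eq_norm_sq_to_K] at h1
    have h2 : ‖f x‖ ^ 2 = ‖g x‖ ^ 2 := by exact_mod_cast h1
    exact (sq_eq_sq₀ (norm_nonneg _) (norm_nonneg _)).1 h2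
  obtain ⟨s, hs⟩ := g.rangeRestrict.exists_rightInverse_of_surjective g.range_rangeRestrict
  have hs' : ∀ y, g (s y) = y := fun y => congrArg Subtype.val (LinearMap.congr_fun hs y)
  -- The assignment `g x ↦ f x` is well defined and isometric on the range of `g` because `‖f x‖ =
  -- ‖g x‖`; `s` is a linear section of `g`.
  let L : LinearMap.range g →ₗᵢ[ℂ] EuclideanSpace ℂ ι :=
    ⟨f ∘ₗ s, fun y => by
      rw [LinearMap.comp_apply, hnorm, hs']; rfl⟩
  have hL : ∀ x, L.extend (g x) = f x := by
    intro x
    have : L.extend (g x) = f (s (g.rangeRestrict x)) := L.extend_apply (g.rangeRestrict x)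
    rw [this, ← sub_eq_zero, ← map_sub, ← norm_eq_zero, hnorm, map_sub, hs', norm_eq_zero,
      sub_eq_zero]
    rfl
  refine ⟨toEuclideanLin.symm L.extend.toLinearMap, ?_, ?_⟩
  · apply toEuclideanLin.injective
    rw [toEuclideanLin_mul, toEuclideanLin_conjTranspose_eq_adjoint, LinearEquiv.apply_symm_apply]
    ext1 x
    apply ext_inner_left ℂ
    intro y
    rw [LinearMap.comp_apply, LinearMap.adjoint_inner_right]
    refine (L.extend.inner_map_map y x).trans ?_
    simp
  · exact hA _ hL

/-- The polar decomposition of a square matrix. -/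
theorem exists_polar {ι : Type*} [Fintype ι] [DecidableEq ι] (A : Matrix ι ι ℂ) :
    ∃ V : Matrix ι ι ℂ, Vᴴ * V = 1 ∧ A = V * CFC.sqrt (Aᴴ * A) := by
  have h0 : 0 ≤ Aᴴ * A := (posSemidef_conjTranspose_mul_self A).nonneg
  refine exists_unitary_mul_of_gram_eq A _ ?_
  have h1 : (CFC.sqrt (Aᴴ * A))ᴴ = CFC.sqrt (Aᴴ * A) :=
    (CFC.sqrt_nonneg (Aᴴ * A)).posSemidef.isHermitian
  rw [h1, CFC.sqrt_mul_sqrt_self _ h0]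

/-- Every contraction is the mean of two unitaries. -/
theorem exists_unitary_add_sub {ι : Type*} [Fintype ι] [DecidableEq ι] (A : Matrix ι ι ℂ)
    (hA : (1 - Aᴴ * A).PosSemidef) :
    ∃ B : Matrix ι ι ℂ, A + B ∈ unitaryGroup ι ℂ ∧ A - B ∈ unitaryGroup ι ℂ := by
  obtain ⟨V, hV, hVA⟩ := exists_polar A
  have h0 : 0 ≤ Aᴴ * A := (posSemidef_conjTranspose_mul_self A).nonneg
  set T := CFC.sqrt (Aᴴ * A)
  set S := CFC.sqrt (1 - Aᴴ * A)
  have hT : Tᴴ = T := (CFC.sqrt_nonneg (Aᴴ * A)).posSemidef.isHermitian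
  have hS : Sᴴ = S := (CFC.sqrt_nonneg (1 - Aᴴ * A)).posSemidef.isHermitian
  have hTT : T * T = Aᴴ * A := CFC.sqrt_mul_sqrt_self _ h0
  have hSS : S * S = 1 - Aᴴ * A := CFC.sqrt_mul_sqrt_self _ hA.nonneg
  have hc : Commute T S := by
    have h1 : Commute (Aᴴ * A) (1 - Aᴴ * A) := (Commute.one_right _).sub_right (Commute.refl _)
    have h2 : Commute T (1 - Aᴴ * A) := h1.cfcₙ_nnreal _
    exact (h2.symm.cfcₙ_nnreal _).symm
  have hsum : T * T + S * S = 1 := by rw [hTT, hSS]; abel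
  -- The conditions on `z` say `z = ± i`. Then `A + z V S = V (T + z S)`, and since `T` and `S`
  -- commute the Gram matrix is `T² + S² = 1`.
  have key : ∀ z : ℂ, star z * z = 1 → star z + z = 0 →
      A + z • (V * S) ∈ unitaryGroup ι ℂ := by
    intro z hz hz'
    rw [mem_unitaryGroup_iff', star_eq_conjTranspose]
    have e : A + z • (V * S) = V * (T + z • S) := by
      rw [mul_add, ← hVA, Matrix.mul_smul]
    rw [e, conjTranspose_mul, Matrix.mul_assoc, ← Matrix.mul_assoc Vᴴ, hV, Matrix.one_mul,
      conjTranspose_add, conjTranspose_smul, hT, hS]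
    have hz2 : star z = -z := eq_neg_of_add_eq_zero_left hz'
    have hz3 : z * z = -1 := by rw [hz2] at hz; linear_combination -hz
    simp only [hz2, add_mul, mul_add, Matrix.smul_mul, Matrix.mul_smul, smul_smul, neg_smul,
      neg_mul, hz3, hc.eq]
    rw [← hsum, one_smul]; abel
  refine ⟨Complex.I • (V * S), key _ (by simp) (by simp), ?_⟩
  have := key (-Complex.I) (by simp) (by simp)
  rwa [neg_smul, ← sub_eq_add_neg] at this

/-! ### The trace norm: duality with unitaries and contraction estimates. -/

section TraceNorm

variable {ι κ τ : Type*} [Fintype ι] [Fintype κ] [Fintype τ]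

/-- The arithmetic-geometric mean form of the Cauchy-Schwarz inequality for the trace. -/
theorem two_mul_re_trace_mul_le (Y : Matrix ι κ ℂ) (Z : Matrix κ ι ℂ) :
    2 * (Y * Z).trace.re ≤ (Y * Yᴴ).trace.re + (Zᴴ * Z).trace.re := by
  have h := (Complex.le_def.1 (posSemidef_conjTranspose_mul_self (Yᴴ - Z)).trace_nonneg).1
  have h2 : (Zᴴ * Yᴴ).trace.re = (Y * Z).trace.re := by
    rw [← conjTranspose_mul, trace_conjTranspose]; simp
  rw [conjTranspose_sub, conjTranspose_conjTranspose, Matrix.sub_mul, Matrix.mul_sub,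
    Matrix.mul_sub, trace_sub, trace_sub, trace_sub] at h
  simp only [Complex.sub_re, Complex.zero_re, h2] at h
  linarith

variable [DecidableEq ι]

theorem re_trace_conj_le {R : Matrix ι ι ℂ} {c : ℝ} (hR : ((c : ℂ) • 1 - R).PosSemidef)
    (M : Matrix ι κ ℂ) : (Mᴴ * R * M).trace.re ≤ c * (Mᴴ * M).trace.re := by
  have h := (Complex.le_def.1 (hR.conjTranspose_mul_mul_same M).trace_nonneg).1
  rw [Matrix.mul_sub, Matrix.sub_mul, trace_sub, Matrix.mul_smul, Matrix.smul_mul, Matrix.mul_one,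
    trace_smul] at h
  simp only [Complex.sub_re, Complex.zero_re, smul_eq_mul, Complex.re_ofReal_mul] at h
  linarith

/-- A polar decomposition in which the positive part is written as a square. -/
theorem exists_polar_sq (X : Matrix ι ι ℂ) :
    ∃ V Q : Matrix ι ι ℂ, Vᴴ * V = 1 ∧ Qᴴ = Q ∧ X = V * (Q * Q) ∧
      traceNorm X = (Q * Q).trace.re := by
  obtain ⟨V, hV, hX⟩ := exists_polar X
  have hP := CFC.sqrt_nonneg (Xᴴ * X)
  have hQ : CFC.sqrt (CFC.sqrt (Xᴴ * X)) * CFC.sqrt (CFC.sqrt (Xᴴ * X)) = CFC.sqrt (Xᴴ * X) :=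
    CFC.sqrt_mul_sqrt_self _ hP
  exact ⟨V, CFC.sqrt (CFC.sqrt (Xᴴ * X)), hV,
    (CFC.sqrt_nonneg (CFC.sqrt (Xᴴ * X))).posSemidef.isHermitian, by rw [hQ]; exact hX,
    by rw [hQ]; rfl⟩

theorem traceNorm_of_posSemidef {X : Matrix ι ι ℂ} (hX : X.PosSemidef) :
    traceNorm X = X.trace.re := by
  have h : Xᴴ = X := hX.isHermitian
  rw [traceNorm, h, CFC.sqrt_mul_self X hX.nonneg]

theorem traceNorm_nonneg (X : Matrix ι ι ℂ) : 0 ≤ traceNorm X :=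
  (Complex.le_def.1 (CFC.sqrt_nonneg (Xᴴ * X)).posSemidef.trace_nonneg).1

/-- Writing `X = V Q²`, the trace is that of `Q` times `W V Q`; both factors have squared
Hilbert-Schmidt norm `Tr Q² = ‖X‖₁`. -/
theorem re_trace_le_traceNorm {W : Matrix ι ι ℂ} (hW : Wᴴ * W = 1) (X : Matrix ι ι ℂ) :
    (W * X).trace.re ≤ traceNorm X := by
  obtain ⟨V, Q, hV, hQ, hX, hn⟩ := exists_polar_sq X
  have h := two_mul_re_trace_mul_le Q (W * V * Q)
  have h1 : (Q * (W * V * Q)).trace = (W * X).trace := by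
    rw [trace_mul_comm, hX]; simp only [Matrix.mul_assoc]
  have h2 : (W * V * Q)ᴴ * (W * V * Q) = Q * Q := by
    calc (W * V * Q)ᴴ * (W * V * Q) = Qᴴ * (Vᴴ * ((Wᴴ * W) * V)) * Q := by
          simp only [conjTranspose_mul, Matrix.mul_assoc]
      _ = Q * Q := by rw [hW, Matrix.one_mul, hV, Matrix.mul_one, hQ]
  rw [h1, h2, hQ, ← hn] at h
  linarith

/-- The trace norm is attained by a unitary. -/
theorem exists_re_trace_eq_traceNorm (X : Matrix ι ι ℂ) :
    ∃ W : Matrix ι ι ℂ, Wᴴ * W = 1 ∧ (W * X).trace.re = traceNorm X := by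
  obtain ⟨V, Q, hV, -, hX, hn⟩ := exists_polar_sq X
  refine ⟨Vᴴ, by rw [conjTranspose_conjTranspose]; exact mul_eq_one_comm.1 hV, ?_⟩
  rw [hX, ← Matrix.mul_assoc, hV, Matrix.one_mul, ← hX, hn]

theorem traceNorm_add_le (X Y : Matrix ι ι ℂ) :
    traceNorm (X + Y) ≤ traceNorm X + traceNorm Y := by
  obtain ⟨W, hW, h⟩ := exists_re_trace_eq_traceNorm (X + Y)
  rw [← h, mul_add, trace_add, Complex.add_re]
  exact add_le_add (re_trace_le_traceNorm hW X) (re_trace_le_traceNorm hW Y)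

theorem traceNorm_neg_le (X : Matrix ι ι ℂ) : traceNorm (-X) ≤ traceNorm X := by
  obtain ⟨W, hW, h⟩ := exists_re_trace_eq_traceNorm (-X)
  rw [← h, mul_neg, ← neg_mul]
  exact re_trace_le_traceNorm (by simpa using hW) X

variable [DecidableEq κ]

/-- The map `X ↦ ∑ₖ Aₖ X Bₖ` expands the trace norm at most by the factor `c` when
`∑ₖ Aₖ† Aₖ ≤ c` and `∑ₖ Bₖ Bₖ† ≤ c`. -/
theorem traceNorm_sum_mul_mul_le {c : ℝ} (A : τ → Matrix κ ι ℂ) (B : τ → Matrix ι κ ℂ)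
    (hA : ((c : ℂ) • 1 - ∑ k, (A k)ᴴ * A k).PosSemidef)
    (hB : ((c : ℂ) • 1 - ∑ k, B k * (B k)ᴴ).PosSemidef) (X : Matrix ι ι ℂ) :
    traceNorm (∑ k, A k * X * B k) ≤ c * traceNorm X := by
  obtain ⟨W, hW, h⟩ := exists_re_trace_eq_traceNorm (∑ k, A k * X * B k)
  obtain ⟨V, Q, hV, hQ, hX, hn⟩ := exists_polar_sq X
  have hV' : V * Vᴴ = 1 := mul_eq_one_comm.1 hV
  -- Cyclicity splits the trace so that the mean inequality sees only `B_k B_k†` and `A_k† A_k`.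
  have h1 : ∀ k, (W * (A k * X * B k)).trace = (Q * B k * (W * A k * V * Q)).trace := by
    intro k
    rw [Matrix.mul_assoc Q, trace_mul_comm Q, Matrix.mul_assoc (B k), trace_mul_comm (B k), hX]
    simp only [Matrix.mul_assoc]
  have h2 : ∀ k, 2 * (W * (A k * X * B k)).trace.re ≤
      (Q * (B k * (B k)ᴴ) * Q).trace.re + ((V * Q)ᴴ * ((A k)ᴴ * A k) * (V * Q)).trace.re := by
    intro k
    rw [h1]
    refine (two_mul_re_trace_mul_le _ _).trans_eq ?_
    congr 3
    · simp only [conjTranspose_mul, hQ, Matrix.mul_assoc]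
    · calc _ = (V * Q)ᴴ * ((A k)ᴴ * ((Wᴴ * W) * (A k))) * (V * Q) := by
            simp only [conjTranspose_mul, Matrix.mul_assoc]
        _ = _ := by rw [hW, Matrix.one_mul]
  have h3 := Finset.sum_le_sum fun k (_ : k ∈ Finset.univ) => h2 k
  have h4 := re_trace_conj_le hB Q
  have h5 := re_trace_conj_le hA (V * Q)
  have h6 : (V * Q)ᴴ * (V * Q) = Q * Q := by
    calc _ = Qᴴ * (Vᴴ * V) * Q := by simp only [conjTranspose_mul, Matrix.mul_assoc]
      _ = _ := by rw [hV, Matrix.mul_one, hQ]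
  rw [hQ, ← hn] at h4
  rw [h6, ← hn] at h5
  rw [Finset.sum_add_distrib, ← Finset.mul_sum] at h3
  simp only [← Complex.re_sum, ← trace_sum, ← Matrix.mul_sum, ← Matrix.sum_mul] at h3
  rw [h] at h3
  linarith

theorem traceNorm_smul (c : ℝ) (hc : 0 ≤ c) (X : Matrix ι ι ℂ) :
    traceNorm ((c : ℂ) • X) = c * traceNorm X := by
  apply le_antisymm
  · obtain ⟨W, hW, h⟩ := exists_re_trace_eq_traceNorm ((c : ℂ) • X)
    rw [← h, Matrix.mul_smul, trace_smul, smul_eq_mul, Complex.re_ofReal_mul]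
    exact mul_le_mul_of_nonneg_left (re_trace_le_traceNorm hW X) hc
  · obtain ⟨W, hW, h⟩ := exists_re_trace_eq_traceNorm X
    rw [← h, ← Complex.re_ofReal_mul, ← smul_eq_mul, ← trace_smul, ← Matrix.mul_smul]
    exact re_trace_le_traceNorm hW _

/-- `1 - K†K` is an orthogonal projection, hence its own Gram matrix. -/
theorem posSemidef_one_sub_of_coisometry {K : Matrix κ ι ℂ} (hK : K * Kᴴ = 1) :
    (1 - Kᴴ * K).PosSemidef := by
  have e : (1 - Kᴴ * K)ᴴ * (1 - Kᴴ * K) = 1 - Kᴴ * K := by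
    have : Kᴴ * K * (Kᴴ * K) = Kᴴ * K := by
      rw [Matrix.mul_assoc, ← Matrix.mul_assoc K, hK, Matrix.one_mul]
    simp only [conjTranspose_sub, conjTranspose_one, conjTranspose_mul,
      conjTranspose_conjTranspose, sub_mul, mul_sub, Matrix.one_mul, Matrix.mul_one, this]
    abel
  rw [← e]
  exact posSemidef_conjTranspose_mul_self _

/-- Cutting down by a coisometry does not increase the trace norm. -/
theorem traceNorm_compress_le {K : Matrix κ ι ℂ} (hK : K * Kᴴ = 1) (X : Matrix ι ι ℂ) :
    traceNorm (K * X * Kᴴ) ≤ traceNorm X := by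
  have hp := posSemidef_one_sub_of_coisometry hK
  have := traceNorm_sum_mul_mul_le (c := 1) (fun _ : Unit => K) (fun _ => Kᴴ)
    (by simpa using hp) (by simpa using hp) X
  simpa using this

/-- Embedding by an isometry does not increase the trace norm. -/
theorem traceNorm_embed_le {K : Matrix κ ι ℂ} (hK : K * Kᴴ = 1) (X : Matrix κ κ ℂ) :
    traceNorm (Kᴴ * X * K) ≤ traceNorm X := by
  have := traceNorm_sum_mul_mul_le (c := 1) (fun _ : Unit => Kᴴ) (fun _ => K)
    (by simpa [hK] using PosSemidef.zero) (by simpa [hK] using PosSemidef.zero) X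
  simpa using this

end TraceNorm

/-! ### The diamond norm under compression, subtraction and completely positive maps. -/

section Diamond

theorem sum_kronecker {ι κ τ : Type*} [Fintype τ] (A : τ → Matrix ι ι ℂ) (B : Matrix κ κ ℂ) :
    (∑ k, A k) ⊗ₖ B = ∑ k, A k ⊗ₖ B := by
  ext p q
  simp [Matrix.sum_apply, Finset.sum_mul]

variable {ι κ ν τ : Type*} [Fintype ι] [DecidableEq ι] [Fintype κ] [DecidableEq κ]
  [Fintype ν] [DecidableEq ν] [Fintype τ]

theorem tensor_add_left (Θ₁ Θ₂ : SuperOp ι) (Ψ : SuperOp κ) :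
    tensor (Θ₁ + Θ₂) Ψ = tensor Θ₁ Ψ + tensor Θ₂ Ψ := by
  ext1 X
  simp only [tensor, LinearMap.coe_mk, AddHom.coe_mk, LinearMap.add_apply, add_kronecker, smul_add,
    Finset.sum_add_distrib]

theorem tensor_neg_left (Θ : SuperOp ι) (Ψ : SuperOp κ) : tensor (-Θ) Ψ = -tensor Θ Ψ := by
  rw [eq_neg_iff_add_eq_zero, ← tensor_add_left, neg_add_cancel]
  ext1 X
  simp [tensor]

/-- Super-operators on a tensor product are determined by their values on product operators. -/
theorem linearMap_ext_kronecker {M : Type*} [AddCommGroup M] [Module ℂ M]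
    {f g : Matrix (ι × κ) (ι × κ) ℂ →ₗ[ℂ] M}
    (h : ∀ (A : Matrix ι ι ℂ) (B : Matrix κ κ ℂ), f (A ⊗ₖ B) = g (A ⊗ₖ B)) : f = g := by
  refine Matrix.ext_linearMap ℂ fun p q => LinearMap.ext_ring ?_
  have := h (single p.1 q.1 1) (single p.2 q.2 1)
  rwa [single_kronecker_single, mul_one] at this

/-- The compression `X ↦ K Θ(K† X K) K†` of a super-operator. -/
noncomputable def compress (K : Matrix κ ι ℂ) (Θ : SuperOp ι) : SuperOp κ where
  toFun X := K * Θ (Kᴴ * X * K) * Kᴴ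
  map_add' X Y := by simp only [Matrix.mul_add, Matrix.add_mul, map_add]
  map_smul' c X := by simp only [Matrix.mul_smul, Matrix.smul_mul, map_smul, RingHom.id_apply]

/-- An ancilla only replaces `K` by the coisometry `K ⊗ 1`, so diamond norm bounds follow from trace
norm bounds. -/
theorem tensor_compress_id (K : Matrix κ ι ℂ) (Θ : SuperOp ι) :
    tensor (compress K Θ) (LinearMap.id : SuperOp ν) =
      compress (K ⊗ₖ (1 : Matrix ν ν ℂ)) (tensor Θ LinearMap.id) := by
  apply linearMap_ext_kronecker
  intro A B
  simp only [tensor_kronecker, compress, LinearMap.coe_mk, AddHom.coe_mk, conjTranspose_kronecker,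
    conjTranspose_one, ← mul_kronecker_mul, Matrix.one_mul, Matrix.mul_one, LinearMap.id_apply]

theorem superTraceNorm_compress_le {K : Matrix κ ι ℂ} (hK : K * Kᴴ = 1) (Θ : SuperOp ι) :
    superTraceNorm (compress K Θ) ≤ superTraceNorm Θ := by
  refine iSup₂_le fun X hX => ?_
  refine le_trans ?_ (le_iSup₂ (f := fun (X : Matrix ι ι ℂ) (_ : traceNorm X ≤ 1) =>
    ENNReal.ofReal (traceNorm (Θ X))) (Kᴴ * X * K) ((traceNorm_embed_le hK X).trans hX))
  exact ENNReal.ofReal_le_ofReal (traceNorm_compress_le hK _)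

theorem diamondNorm_compress_le {K : Matrix κ ι ℂ} (hK : K * Kᴴ = 1) (Θ : SuperOp ι) :
    diamondNorm (compress K Θ) ≤ diamondNorm Θ := by
  refine iSup₂_mono fun n _ => ?_
  rw [tensor_compress_id]
  refine superTraceNorm_compress_le ?_ _
  rw [conjTranspose_kronecker, ← mul_kronecker_mul, hK, conjTranspose_one, Matrix.one_mul,
    one_kronecker_one]

theorem diamondNorm_sub_le (Θ₁ Θ₂ : SuperOp ι) :
    diamondNorm (Θ₁ - Θ₂) ≤ diamondNorm Θ₁ + diamondNorm Θ₂ := by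
  refine iSup₂_le fun n hn => iSup₂_le fun X hX => ?_
  have h : ∀ Θ : SuperOp ι, ENNReal.ofReal
      (traceNorm (tensor Θ (LinearMap.id : SuperOp (Fin n)) X)) ≤ diamondNorm Θ := fun Θ =>
    (le_iSup₂ (f := fun (X : Matrix (ι × Fin n) (ι × Fin n) ℂ) (_ : traceNorm X ≤ 1) =>
      ENNReal.ofReal (traceNorm (tensor Θ (LinearMap.id : SuperOp (Fin n)) X))) X hX).trans
      (le_iSup₂ (f := fun (n : ℕ) (_ : 1 ≤ n) =>
        superTraceNorm (tensor Θ (LinearMap.id : SuperOp (Fin n)))) n hn)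
  refine le_trans ?_ (add_le_add (h Θ₁) (h Θ₂))
  rw [← ENNReal.ofReal_add (traceNorm_nonneg _) (traceNorm_nonneg _), sub_eq_add_neg,
    tensor_add_left, tensor_neg_left]
  exact ENNReal.ofReal_le_ofReal ((traceNorm_add_le _ _).trans
    (add_le_add_right (traceNorm_neg_le _) _))

/-- The completely positive map `X ↦ ∑ₖ Aₖ X Aₖ†` has diamond norm at most `c` when
`∑ₖ Aₖ† Aₖ ≤ c`. -/
theorem diamondNorm_sum_conjBy_le {c : ℝ} (hc : 0 ≤ c) (A : τ → Matrix ι ι ℂ)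
    (hA : ((c : ℂ) • 1 - ∑ k, (A k)ᴴ * A k).PosSemidef) :
    diamondNorm (∑ k, conjBy (A k)) ≤ ENNReal.ofReal c := by
  refine iSup₂_le fun n _ => iSup₂_le fun X hX => ENNReal.ofReal_le_ofReal ?_
  have e : tensor (∑ k, conjBy (A k)) (LinearMap.id : SuperOp (Fin n)) =
      ∑ k, conjBy (A k ⊗ₖ (1 : Matrix (Fin n) (Fin n) ℂ)) := by
    apply linearMap_ext_kronecker
    intro Y Z
    simp only [tensor_kronecker, LinearMap.sum_apply, conjBy, LinearMap.coe_mk, AddHom.coe_mk,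
      conjTranspose_kronecker, conjTranspose_one, ← mul_kronecker_mul, Matrix.one_mul,
      Matrix.mul_one, LinearMap.id_apply]
    exact sum_kronecker _ _
  have hp : ((c : ℂ) • 1 - ∑ k, (A k ⊗ₖ (1 : Matrix (Fin n) (Fin n) ℂ))ᴴ *
      (A k ⊗ₖ (1 : Matrix (Fin n) (Fin n) ℂ))).PosSemidef := by
    have := hA.kronecker (PosSemidef.one (n := Fin n) (R := ℂ))
    rw [sub_eq_add_neg, add_kronecker, ← neg_one_smul ℂ (∑ k, _), smul_kronecker, smul_kronecker,
      one_kronecker_one, sum_kronecker, neg_one_smul, ← sub_eq_add_neg] at this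
    simpa only [conjTranspose_kronecker, conjTranspose_one, ← mul_kronecker_mul,
      Matrix.one_mul] using! this
  rw [e, LinearMap.sum_apply]
  refine (traceNorm_sum_mul_mul_le _ _ hp
    (by simpa only [conjTranspose_conjTranspose] using hp) X).trans ?_
  exact mul_le_of_le_one_right hc hX

end Diamond

/-! ### From mixtures of contractive conjugations to mixtures of unitary channels. -/

section Mixtures

variable {ι κ τ : Type*} [Fintype ι] [Fintype κ] [Fintype τ]

/-- The parallelogram identity for conjugations. -/
theorem half_conjBy_add_half_conjBy (C D : Matrix ι ι ℂ) :
    (1 / 2 : ℝ) • conjBy (C + D) + (1 / 2 : ℝ) • conjBy (C - D) = conjBy C + conjBy D := by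
  ext1 X
  simp only [conjBy, LinearMap.add_apply, LinearMap.smul_apply, LinearMap.coe_mk, AddHom.coe_mk,
    conjTranspose_add, conjTranspose_sub, Matrix.add_mul, Matrix.mul_add, Matrix.sub_mul,
    Matrix.mul_sub]
  module

theorem compress_conjBy (K : Matrix κ ι ℂ) (U : Matrix ι ι ℂ) :
    compress K (conjBy U) = conjBy (K * U * Kᴴ) := by
  ext1 X
  simp [compress, conjBy, conjTranspose_mul, Matrix.mul_assoc]

theorem compress_sub_sum (K : Matrix κ ι ℂ) (Θ : SuperOp ι) (w : τ → ℝ) (Ξ : τ → SuperOp ι) :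
    compress K (Θ - ∑ k, w k • Ξ k) = compress K Θ - ∑ k, w k • compress K (Ξ k) := by
  ext1 X
  simp only [compress, LinearMap.sub_apply, LinearMap.sum_apply, LinearMap.smul_apply,
    LinearMap.coe_mk, AddHom.coe_mk, Matrix.mul_sub, Matrix.sub_mul, Matrix.mul_sum,
    Matrix.sum_mul, Matrix.mul_smul, Matrix.smul_mul]

theorem trace_schurMultiplier {S : Matrix ι ι ℂ} (hS : ∀ k, S k k = 1) (X : Matrix ι ι ℂ) :
    (schurMultiplier S X).trace = X.trace := by
  simp [schurMultiplier, trace, hS]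

variable [DecidableEq ι] [DecidableEq κ]

/-- The diamond norm bounds the trace of the image of a positive semidefinite matrix. -/
theorem re_trace_apply_le {Θ : SuperOp ι} {e : ℝ} (he : 0 ≤ e)
    (hΘ : diamondNorm Θ ≤ ENNReal.ofReal e) {X : Matrix ι ι ℂ} (hX : X.PosSemidef) :
    (Θ X).trace.re ≤ e * X.trace.re := by
  obtain ⟨ht, hi⟩ := Complex.le_def.1 hX.trace_nonneg
  simp only [Complex.zero_re, Complex.zero_im] at ht hi
  rcases ht.eq_or_lt with h0 | hpos
  · have : X = 0 := hX.trace_eq_zero_iff.1 (Complex.ext h0.symm hi.symm)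
    simp [this]
  set t := X.trace.re
  -- A one-dimensional ancilla suffices; dividing by the trace gives a test operator of trace norm
  -- `1`.
  have hk : (X ⊗ₖ (1 : Matrix (Fin 1) (Fin 1) ℂ)).PosSemidef := hX.kronecker PosSemidef.one
  have hn : traceNorm ((t⁻¹ : ℝ) • (X ⊗ₖ (1 : Matrix (Fin 1) (Fin 1) ℂ))) = 1 := by
    rw [← Complex.coe_smul, traceNorm_smul _ (inv_nonneg.2 ht),
      traceNorm_of_posSemidef hk, trace_kronecker]
    simp only [trace_one, Fintype.card_fin, Nat.cast_one, mul_one]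
    exact inv_mul_cancel₀ hpos.ne'
  have h1 : ENNReal.ofReal (traceNorm (tensor Θ (LinearMap.id : SuperOp (Fin 1))
      ((t⁻¹ : ℝ) • (X ⊗ₖ (1 : Matrix (Fin 1) (Fin 1) ℂ))))) ≤ ENNReal.ofReal e :=
    ((le_iSup₂ (f := fun (X : Matrix (ι × Fin 1) (ι × Fin 1) ℂ) (_ : traceNorm X ≤ 1) =>
      ENNReal.ofReal (traceNorm (tensor Θ (LinearMap.id : SuperOp (Fin 1)) X))) _ hn.le).trans
      (le_iSup₂ (f := fun (n : ℕ) (_ : 1 ≤ n) =>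
        superTraceNorm (tensor Θ (LinearMap.id : SuperOp (Fin n)))) 1 le_rfl)).trans hΘ
  rw [ENNReal.ofReal_le_ofReal_iff he, ← Complex.coe_smul, map_smul, tensor_kronecker,
    traceNorm_smul _ (inv_nonneg.2 ht), inv_mul_le_iff₀ hpos, LinearMap.id_apply] at h1
  have h2 := re_trace_le_traceNorm (W := 1) (by simp) (Θ X ⊗ₖ (1 : Matrix (Fin 1) (Fin 1) ℂ))
  rw [Matrix.one_mul, trace_kronecker] at h2
  simp only [trace_one, Fintype.card_fin, Nat.cast_one, mul_one] at h2
  linarith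

/-- Testing on the rank-one matrices `v v†` recovers the quadratic form. -/
theorem posSemidef_smul_one_sub {R : Matrix ι ι ℂ} (hR : R.IsHermitian) {e : ℝ}
    (h : ∀ X : Matrix ι ι ℂ, X.PosSemidef → (R * X).trace.re ≤ e * X.trace.re) :
    ((e : ℂ) • 1 - R).PosSemidef := by
  have hH : ((e : ℂ) • 1 - R).IsHermitian := by
    refine IsHermitian.sub ?_ hR
    rw [IsHermitian, conjTranspose_smul, conjTranspose_one]; simp
  refine PosSemidef.of_dotProduct_mulVec_nonneg hH fun v => ?_
  have h1 := h (vecMulVec v (star v)) (posSemidef_vecMulVec_self_star v)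
  rw [Complex.le_def]
  refine ⟨?_, (hH.im_star_dotProduct_mulVec_self v).symm⟩
  rw [mul_vecMulVec, trace_vecMulVec, trace_vecMulVec] at h1
  rw [sub_mulVec, smul_mulVec, one_mulVec, dotProduct_sub, dotProduct_smul, smul_eq_mul,
    Complex.sub_re, Complex.re_ofReal_mul, dotProduct_comm _ v, dotProduct_comm _ (R *ᵥ v)]
  simpa using h1

theorem conjBy_sqrt_smul {r : ℝ} (hr : 0 ≤ r) (U : Matrix ι ι ℂ) :
    conjBy ((√r : ℝ) • U) = r • conjBy U := by
  ext1 X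
  simp [conjBy, conjTranspose_smul, smul_smul, Real.mul_self_sqrt hr]

theorem conjBy_mem_unitaryMixtures {U : Matrix ι ι ℂ} (hU : U ∈ unitaryGroup ι ℂ) :
    conjBy U ∈ unitaryMixtures ι :=
  subset_convexHull ℝ _ ⟨U, hU, rfl⟩

theorem gram_add_gram_eq_one {C D : Matrix ι ι ℂ} (h₁ : C + D ∈ unitaryGroup ι ℂ)
    (h₂ : C - D ∈ unitaryGroup ι ℂ) : Cᴴ * C + Dᴴ * D = 1 := by
  rw [mem_unitaryGroup_iff', star_eq_conjTranspose] at h₁ h₂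
  have e : (2 : ℂ) • (Cᴴ * C + Dᴴ * D) = (C + D)ᴴ * (C + D) + (C - D)ᴴ * (C - D) := by
    simp only [conjTranspose_add, conjTranspose_sub, Matrix.add_mul, Matrix.mul_add, Matrix.sub_mul,
      Matrix.mul_sub]
    module
  rw [h₁, h₂, ← two_smul ℂ (1 : Matrix ι ι ℂ)] at e
  exact smul_right_injective _ two_ne_zero e

/-- A trace preserving map close to a mixture of contractive conjugations is close, up to a
factor `2`, to a mixture of unitary channels. -/
theorem exists_unitaryMixture_near {Φ : SuperOp ι} (hΦ : ∀ X, (Φ X).trace = X.trace)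
    {w : τ → ℝ} (hw : ∀ k, 0 ≤ w k) (hw1 : ∑ k, w k = 1) (C : τ → Matrix ι ι ℂ)
    (hC : ∀ k, (1 - (C k)ᴴ * C k).PosSemidef) {e : ℝ} (he : 0 ≤ e)
    (h : diamondNorm (Φ - ∑ k, w k • conjBy (C k)) ≤ ENNReal.ofReal e) :
    ∃ Λ ∈ unitaryMixtures ι, diamondNorm (Φ - Λ) ≤ 2 * ENNReal.ofReal e := by
  choose D hD₁ hD₂ using fun k => exists_unitary_add_sub (C k) (hC k)
  refine ⟨∑ k, w k • (conjBy (C k) + conjBy (D k)), ?_, ?_⟩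
  · refine (convex_convexHull ℝ _).sum_mem (fun k _ => hw k) hw1 fun k _ => ?_
    rw [← half_conjBy_add_half_conjBy]
    exact convex_convexHull ℝ _ (conjBy_mem_unitaryMixtures (hD₁ k))
      (conjBy_mem_unitaryMixtures (hD₂ k)) (by norm_num) (by norm_num) (by norm_num)
  have hR : ∑ k, w k • ((D k)ᴴ * D k) = 1 - ∑ k, w k • ((C k)ᴴ * C k) := by
    rw [eq_sub_iff_add_eq', ← Finset.sum_add_distrib]
    simp only [← smul_add, gram_add_gram_eq_one (hD₁ _) (hD₂ _), ← Finset.sum_smul, hw1, one_smul]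
  -- Trace preservation makes `Tr(R X)` equal to the trace of `Φ - ∑ w_k C_k · C_k†` at `X`, which
  -- the diamond norm bounds by `e Tr X`.
  have hB : ((e : ℂ) • 1 - ∑ k, w k • ((D k)ᴴ * D k)).PosSemidef := by
    refine posSemidef_smul_one_sub ?_ fun X hX => ?_
    · simp [IsHermitian, conjTranspose_sum, conjTranspose_smul, conjTranspose_mul]
    · refine Eq.trans_le ?_ (re_trace_apply_le he h hX)
      congr 1
      rw [hR, Matrix.sub_mul, Matrix.one_mul, trace_sub, LinearMap.sub_apply, trace_sub, hΦ,
        LinearMap.sum_apply, Matrix.sum_mul, trace_sum, trace_sum]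
      congr 1
      refine Finset.sum_congr rfl fun k _ => ?_
      rw [LinearMap.smul_apply, Matrix.smul_mul, trace_smul, trace_smul]
      congr 1
      exact (trace_mul_cycle (C k) X (C k)ᴴ).symm
  -- The weights are absorbed as `√w_k` to fit the bound for sums of conjugations.
  have hdec : Φ - ∑ k, w k • (conjBy (C k) + conjBy (D k)) =
      (Φ - ∑ k, w k • conjBy (C k)) - ∑ k, conjBy (√(w k) • D k) := by
    simp only [smul_add, Finset.sum_add_distrib, conjBy_sqrt_smul (hw _)]
    abel
  rw [hdec, two_mul]
  refine (diamondNorm_sub_le _ _).trans (add_le_add h (diamondNorm_sum_conjBy_le he _ ?_))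
  convert hB using 4 with k
  rw [conjTranspose_smul, Matrix.smul_mul, Matrix.mul_smul, smul_smul, star_trivial,
    Real.mul_self_sqrt (hw k)]

/-- The coisometry `ℂ^κ ⊗ ℂ^ι → ℂ^ι` that picks out the block of a basis vector. -/
def blockProj (ι : Type*) [DecidableEq ι] {κ : Type*} [DecidableEq κ] (k : κ) :
    Matrix ι (κ × ι) ℂ :=
  fun i p => if p = (k, i) then 1 else 0

theorem conjTranspose_blockProj_mul_mul {ι κ : Type*} [Fintype ι] [DecidableEq ι]
    [DecidableEq κ] (k : κ) (X : Matrix ι ι ℂ) :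
    (blockProj ι k)ᴴ * X * blockProj ι k = single k k 1 ⊗ₖ X := by
  ext ⟨a, i⟩ ⟨b, j⟩
  rcases eq_or_ne a k with rfl | ha
  · rcases eq_or_ne b a with rfl | hb
    · simp [Matrix.mul_apply, blockProj]
    · simp [Matrix.mul_apply, blockProj, hb, hb.symm]
  · simp [Matrix.mul_apply, blockProj, ha, ha.symm]

theorem blockProj_mul_mul (k : κ) (M : Matrix (κ × ι) (κ × ι) ℂ) :
    blockProj ι k * M * (blockProj ι k)ᴴ = M.submatrix (Prod.mk k) (Prod.mk k) := by
  ext i j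
  simp [Matrix.mul_apply, blockProj]

theorem blockProj_mul_conjTranspose (k : κ) : blockProj ι k * (blockProj ι k)ᴴ = 1 := by
  have := blockProj_mul_mul (ι := ι) k (1 : Matrix (κ × ι) (κ × ι) ℂ)
  rw [Matrix.mul_one] at this
  rw [this, submatrix_one _ (Prod.mk_right_injective k)]

/-- The multiplier fixes `E_kk` because `S k k = 1`, so `E_kk ⊗ X` is sent to `E_kk ⊗ Φ(X)`. -/
theorem compress_blockProj_tensor {S : Matrix κ κ ℂ} {k : κ} (hS : S k k = 1) (Φ : SuperOp ι) :
    compress (blockProj ι k) (tensor (schurMultiplier S) Φ) = Φ := by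
  ext1 X
  have h : schurMultiplier S (single k k 1) = single k k 1 := by
    ext a b
    by_cases hab : k = a ∧ k = b
    · obtain ⟨rfl, rfl⟩ := hab
      simp [schurMultiplier, hS]
    · simp [schurMultiplier, hab]
  have h2 : compress (blockProj ι k) (tensor (schurMultiplier S) Φ) X =
      blockProj ι k * tensor (schurMultiplier S) Φ ((blockProj ι k)ᴴ * X * blockProj ι k) *
        (blockProj ι k)ᴴ := rfl
  rw [h2, conjTranspose_blockProj_mul_mul, tensor_kronecker, h, blockProj_mul_mul]
  ext i j
  simp

/-- The defect is `1 - K†K ≥ 0` conjugated by `U K†`. -/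
theorem posSemidef_one_sub_gram_compress {K : Matrix κ ι ℂ} (hK : K * Kᴴ = 1)
    {U : Matrix ι ι ℂ} (hU : U ∈ unitaryGroup ι ℂ) :
    (1 - (K * U * Kᴴ)ᴴ * (K * U * Kᴴ)).PosSemidef := by
  rw [mem_unitaryGroup_iff', star_eq_conjTranspose] at hU
  have := (posSemidef_one_sub_of_coisometry hK).conjTranspose_mul_mul_same (U * Kᴴ)
  convert this using 1
  rw [Matrix.mul_sub, Matrix.sub_mul, Matrix.mul_one]
  congr 1
  · rw [conjTranspose_mul, conjTranspose_conjTranspose, Matrix.mul_assoc, ← Matrix.mul_assoc Uᴴ,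
      hU, Matrix.one_mul, hK]
  · simp only [conjTranspose_mul, conjTranspose_conjTranspose, Matrix.mul_assoc]

end Mixtures

end SchurChannels

open SchurChannels in
theorem theorem5 (d m : ℕ) (hm : 1 ≤ m)
    (Φ : SchurChannels.SuperOp (Fin d)) (hΦ : Φ ∈ SchurChannels.schurChannels (Fin d))
    (Ψ : SchurChannels.SuperOp (Fin m)) (hΨ : Ψ ∈ SchurChannels.schurChannels (Fin m)) :
    SchurChannels.distTo (SchurChannels.tensor Ψ Φ)
        (SchurChannels.unitaryMixtures (Fin m × Fin d)) ≥
      (1 / 2 : ENNReal) *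
        SchurChannels.distTo Φ (SchurChannels.unitaryMixtures (Fin d)) := by
  obtain ⟨S, -, hS, rfl⟩ := hΨ
  obtain ⟨T, -, hT, rfl⟩ := hΦ
  refine le_iInf₂ fun Ξ hΞ => ?_
  -- An infinite distance is trivial; otherwise it serves as the real number `e`.
  rcases eq_or_ne (diamondNorm (tensor (schurMultiplier S) (schurMultiplier T) - Ξ)) ⊤ with h | h
  · rw [h]; exact le_top
  obtain ⟨τ, _, w, z, hw, hw1, hz, rfl⟩ := mem_convexHull_iff_exists_fintype.1 hΞ
  choose U hU hzU using hz
  have hK := blockProj_mul_conjTranspose (ι := Fin d) (⟨0, hm⟩ : Fin m)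
  have hc := diamondNorm_compress_le hK
    (tensor (schurMultiplier S) (schurMultiplier T) - ∑ k, w k • z k)
  rw [compress_sub_sum, compress_blockProj_tensor (hS _)] at hc
  simp only [hzU, compress_conjBy] at hc h ⊢
  rw [← ENNReal.ofReal_toReal h] at hc ⊢
  obtain ⟨Λ, hΛ, hle⟩ := exists_unitaryMixture_near (trace_schurMultiplier hT) hw hw1 _
    (fun k => posSemidef_one_sub_gram_compress hK (hU k)) ENNReal.toReal_nonneg hc
  refine (mul_le_mul_right ((iInf₂_le Λ hΛ).trans hle) _).trans_eq ?_
  rw [← mul_assoc, one_div, ENNReal.inv_mul_cancel two_ne_zero ENNReal.ofNat_ne_top, one_mul]
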